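/- Let $d$ be a dimension, let $R$ be a $d\times d$ integer matrix that is expansive (all its complex eigenvalues have modulus $>1$), and let $B\subset\mathbb Z^d$ be a finite nonempty set with $N=\#B$. Put $\tau_b(x)=R^{-1}(x+b)$ for $x\in\mathbb R^d$. For a finite nonempty set $D\subset\mathbb Z^d$ let $T(R,D)=\left\{\sum_{k\ge1}R^{-k}b_k : b_k\in D\right\}$ be the attractor, i.e. the unique nonempty compact set with $T(R,D)=\bigcup_{b\in D}\tau_b(T(R,D))$. Let $\mu=\mu(R,B)$ be the equal-weight self-affine measure, i.e. the unique Borel probability measure on $\mathbb R^d$ with $\mu(E)=\frac1N\sum_{b\in B}\mu(\tau_b^{-1}(E))$ for all Borel sets $E$ (equivalently, the infinite convolution $\delta_{R^{-1}B}*\delta_{R^{-2}B}*\cdots$, where $\delta_A=\frac1{\#A}\sum_{a\in A}\delta_a$). Let $\widehat\mu(\xi)=\int e^{-2\pi i\langle\xi,x\rangle}\,d\mu(x)$ and $\mathcal Z=\{\xi\in\mathbb R^d : \widehat\mu(\xi+k)=0\text{ for all }k\in\mathbb Z^d\}$. Consider the following conditions. (i) There is a complete set of representatives $\overline B\supset B$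 of $\mathbb Z^d$ modulo $R\mathbb Z^d$ such that, with $T=T(R,\overline B)$, one has $T(R,B)\cap T^\circ\neq\emptyset$ ($T^\circ$ is the interior of $T$), and such that $T$ is a $\mathbb Z^d$-tile: $\bigcup_{k\in\mathbb Z^d}(T+k)=\mathbb R^d$, and $(T+k)\cap(T+k')$ has Lebesgue measure zero for all $k\ne k'$ in $\mathbb Z^d$. (ii) For all $k\neq k'$ in $\mathbb Z^d$, $\mu\big((T(R,B)+k)\cap(T(R,B)+k')\big)=0$. (iii) $\mathcal Z=\emptyset$. Then (i) $\Rightarrow$ (ii) and (ii) $\Rightarrow$ (iii). -/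

import Mathlib

open MeasureTheory Filter Topology

noncomputable section

namespace SelfAffine

variable {d : ℕ}

/-- An integer matrix is expansive if all its complex eigenvalues have modulus `> 1`. -/
def IsExpansive (R : Matrix (Fin d) (Fin d) ℤ) : Prop :=
  ∀ z : ℂ, Module.End.HasEigenvalue (Matrix.toLin' (R.map (fun n : ℤ => (n : ℂ)))) z → 1 < ‖z‖

/-- An integer vector, seen as a point of `ℝ^d`. -/
def latticeVec (k : Fin d → ℤ) : EuclideanSpace ℝ (Fin d) :=
  WithLp.toLp 2 (fun i => (k i : ℝ))

/-- The linear map `x ↦ R⁻¹ x` of `ℝ^d`. -/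
def invMap (R : Matrix (Fin d) (Fin d) ℤ) :
    EuclideanSpace ℝ (Fin d) →L[ℝ] EuclideanSpace ℝ (Fin d) :=
  Matrix.toEuclideanCLM (n := Fin d) (𝕜 := ℝ) (R.map (fun n : ℤ => (n : ℝ)))⁻¹

/-- The maps `τ_b (x) = R⁻¹ (x + b)` of the affine iterated function system. -/
def tau (R : Matrix (Fin d) (Fin d) ℤ) (b : Fin d → ℤ) (x : EuclideanSpace ℝ (Fin d)) :
    EuclideanSpace ℝ (Fin d) :=
  invMap R (x + latticeVec b)

/-- The sum `∑_{k ≥ 1} R^{-k} b_k` for a sequence of digits `b_1, b_2, …` (here indexed from `0`). -/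
def digitSeries (R : Matrix (Fin d) (Fin d) ℤ) (B : Finset (Fin d → ℤ)) (ω : ℕ → B) :
    EuclideanSpace ℝ (Fin d) :=
  ∑' k : ℕ, (invMap R ^ (k + 1)) (latticeVec (ω k : Fin d → ℤ))

/-- The attractor `T(R,B) = {∑_{k ≥ 1} R^{-k} b_k : b_k ∈ B}`. -/
def attractor (R : Matrix (Fin d) (Fin d) ℤ) (B : Finset (Fin d → ℤ)) :
    Set (EuclideanSpace ℝ (Fin d)) :=
  Set.range (digitSeries R B)

/-- The self-affine measure `μ(R,B)` with equal weights, as the infinite convolution of the uniform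
measures on `R^{-k} B`, that is, as the law of `∑_{k ≥ 1} R^{-k} b_k` for digits `b_k` that are
independent and uniformly distributed on `B`. -/
def selfAffineMeasure (R : Matrix (Fin d) (Fin d) ℤ) (B : Finset (Fin d → ℤ)) :
    Measure (EuclideanSpace ℝ (Fin d)) :=
  (Measure.infinitePi fun _ : ℕ => ProbabilityTheory.uniformOn (Set.univ : Set B)).map
    (digitSeries R B)

/-- `C` contains exactly one element of each residue class of `ℤ^d` modulo `R ℤ^d`. -/
def IsCompleteResidueSystem (R : Matrix (Fin d) (Fin d) ℤ) (C : Finset (Fin d → ℤ)) : Prop :=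
  ∀ z : Fin d → ℤ, ∃! c, c ∈ C ∧ ∃ y : Fin d → ℤ, z - c = R.mulVec y

/-- The translate `T + k` of a set `T ⊆ ℝ^d` by an integer vector `k`. -/
def translate (T : Set (EuclideanSpace ℝ (Fin d))) (k : Fin d → ℤ) :
    Set (EuclideanSpace ℝ (Fin d)) :=
  (fun x => x + latticeVec k) '' T

/-- `T` tiles `ℝ^d` by translation with tiling set `ℤ^d`: the integer translates of `T` cover
`ℝ^d` and distinct ones overlap in a set of Lebesgue measure zero. -/
def IsZdTile (T : Set (EuclideanSpace ℝ (Fin d))) : Prop :=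
  (⋃ k : Fin d → ℤ, translate T k) = Set.univ ∧
    ∀ k k' : Fin d → ℤ, k ≠ k' → volume (translate T k ∩ translate T k') = 0

/-- The `T`-strong open set condition of the IFS `(τ_b)_{b ∈ B}`, with `T = T(R, C)` for the
complete residue system `C` modulo `R ℤ^d`. -/
def TSOSCWith (R : Matrix (Fin d) (Fin d) ℤ) (B C : Finset (Fin d → ℤ)) : Prop :=
  IsCompleteResidueSystem R C ∧ B ⊆ C ∧ (attractor R B ∩ interior (attractor R C)).Nonempty

/-- The Fourier transform `μ̂(ξ) = ∫ e^{-2πi⟨ξ,x⟩} dμ(x)`. -/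
def fourierTransform (μ : Measure (EuclideanSpace ℝ (Fin d))) (ξ : EuclideanSpace ℝ (Fin d)) : ℂ :=
  ∫ x, Complex.exp (-2 * Real.pi * Complex.I * (inner ℝ ξ x : ℝ)) ∂μ

/-- The periodic zero set `Z = {ξ : μ̂(ξ + k) = 0 for all k ∈ ℤ^d}`. -/
def periodicZeroSet (μ : Measure (EuclideanSpace ℝ (Fin d))) : Set (EuclideanSpace ℝ (Fin d)) :=
  {ξ | ∀ k : Fin d → ℤ, fourierTransform μ (ξ + latticeVec k) = 0}

/-! The series and the measure above are well defined for expansive `R`, and `attractor R B` and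
`selfAffineMeasure R B` are the unique solutions of the usual invariance equations. -/

lemma IsExpansive.mem_spectrum {R : Matrix (Fin d) (Fin d) ℤ} (hR : IsExpansive R) {z : ℂ}
    (hz : z ∈ spectrum ℂ (R.map (fun n : ℤ => (n : ℂ)))) : 1 < ‖z‖ := by
  apply hR
  rw [Module.End.hasEigenvalue_iff_mem_spectrum]
  rwa [Matrix.spectrum_toLin']

lemma IsExpansive.isUnit_complex {R : Matrix (Fin d) (Fin d) ℤ} (hR : IsExpansive R) :
    IsUnit (R.map (fun n : ℤ => (n : ℂ))) := by
  by_contra h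
  have := hR.mem_spectrum (spectrum.zero_mem_iff (R := ℂ) |>.2 h)
  norm_num at this

lemma IsExpansive.det_ne_zero {R : Matrix (Fin d) (Fin d) ℤ} (hR : IsExpansive R) :
    R.det ≠ 0 := by
  have h := (Matrix.isUnit_iff_isUnit_det _).1 hR.isUnit_complex
  have h2 : (R.map (fun n : ℤ => (n : ℂ))).det = ((R.det : ℤ) : ℂ) :=
    ((Int.castRingHom ℂ).map_det R).symm
  intro h0
  rw [h2, h0] at h
  simp at h

lemma map_inv_eq {R : Matrix (Fin d) (Fin d) ℤ} (hR : IsExpansive R) :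
    ((R.map (fun n : ℤ => (n : ℝ)))⁻¹).map (fun x : ℝ => (x : ℂ)) =
      (R.map (fun n : ℤ => (n : ℂ)))⁻¹ := by
  symm
  apply Matrix.inv_eq_right_inv
  have hdet : IsUnit (R.map (fun n : ℤ => (n : ℝ))).det := by
    have h2 : (R.map (fun n : ℤ => (n : ℝ))).det = ((R.det : ℤ) : ℝ) :=
      ((Int.castRingHom ℝ).map_det R).symm
    rw [h2, isUnit_iff_ne_zero]
    exact_mod_cast hR.det_ne_zero
  have h := congrArg (fun M : Matrix (Fin d) (Fin d) ℝ => M.map Complex.ofRealHom)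
    (Matrix.mul_nonsing_inv _ hdet)
  simp only [Matrix.map_mul] at h
  refine Eq.trans ?_ (h.trans (Matrix.map_one _ (map_zero _) (map_one _)))
  congr 1

lemma norm_invMap_pow_le {R : Matrix (Fin d) (Fin d) ℤ} (hR : IsExpansive R) (n : ℕ) :
    ‖invMap R ^ n‖ ≤
      ‖(Matrix.toEuclideanCLM (n := Fin d) (𝕜 := ℂ) (R.map (fun n : ℤ => (n : ℂ)))⁻¹) ^ n‖ := by
  rw [invMap, ← map_pow, ← map_pow]
  refine ContinuousLinearMap.opNorm_le_bound _ (norm_nonneg _) fun x => ?_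
  set M := (R.map (fun n : ℤ => (n : ℝ)))⁻¹ ^ n with hM
  have hMc : (R.map (fun n : ℤ => (n : ℂ)))⁻¹ ^ n = M.map Complex.ofRealHom := by
    have h := map_inv_eq hR
    rw [hM, Matrix.map_pow, ← h]
    rfl
  have key : ∀ y : Fin d → ℝ, ‖(WithLp.toLp 2 (fun i => (y i : ℂ)) : EuclideanSpace ℂ (Fin d))‖ =
      ‖(WithLp.toLp 2 y : EuclideanSpace ℝ (Fin d))‖ := by
    intro y
    simp [EuclideanSpace.norm_eq]
  have h1 := ContinuousLinearMap.le_opNorm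
    (Matrix.toEuclideanCLM (n := Fin d) (𝕜 := ℂ) ((R.map (fun n : ℤ => (n : ℂ)))⁻¹ ^ n))
    (WithLp.toLp 2 (fun i => (x i : ℂ)))
  rw [key] at h1
  have h2 : (Matrix.toEuclideanCLM (n := Fin d) (𝕜 := ℂ) ((R.map (fun n : ℤ => (n : ℂ)))⁻¹ ^ n))
      (WithLp.toLp 2 (fun i => (x i : ℂ))) =
      WithLp.toLp 2 (fun i => ((M.mulVec x.ofLp i : ℝ) : ℂ)) := by
    rw [Matrix.toEuclideanCLM_toLp, hMc]
    congr 1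
    ext i
    simp [Matrix.mulVec, dotProduct]
  rw [h2, key] at h1
  exact h1

lemma summable_norm_invMap_pow {R : Matrix (Fin d) (Fin d) ℤ} (hR : IsExpansive R) :
    Summable fun n : ℕ => ‖invMap R ^ n‖ := by
  set S := Matrix.toEuclideanCLM (n := Fin d) (𝕜 := ℂ) (R.map (fun n : ℤ => (n : ℂ)))⁻¹ with hS
  have hspec : ∀ z ∈ spectrum ℂ S, ‖z‖₊ < 1 := by
    intro z hz
    rw [hS, AlgEquiv.spectrum_eq (Matrix.toEuclideanCLM (n := Fin d) (𝕜 := ℂ))] at hz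
    obtain ⟨u, hu⟩ := hR.isUnit_complex
    rw [← hu, ← Matrix.coe_units_inv] at hz
    have hz0 : z ≠ 0 := by
      rintro rfl
      exact (spectrum.zero_mem_iff (R := ℂ)).1 hz u⁻¹.isUnit
    have := (spectrum.inv_mem_iff (r := Units.mk0 z hz0) (a := u⁻¹)).1 hz
    rw [inv_inv, hu] at this
    have h1 := hR.mem_spectrum this
    rw [Units.val_inv_eq_inv_val, Units.val_mk0, norm_inv] at h1
    have h2 : ‖z‖ < 1 := (one_lt_inv₀ (norm_pos_iff.2 hz0)).1 h1
    exact h2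
  have hrad : spectralRadius ℂ S < 1 := by
    by_cases hne : (spectrum ℂ S).Nonempty
    · exact_mod_cast spectrum.spectralRadius_lt_of_forall_lt_of_nonempty hne hspec
    · rw [Set.not_nonempty_iff_eq_empty] at hne
      simp [spectralRadius, hne]
  obtain ⟨r, hr1, hr2⟩ := ENNReal.lt_iff_exists_nnreal_btwn.1 hrad
  have hlim := spectrum.pow_nnnorm_pow_one_div_tendsto_nhds_spectralRadius S
  have hev := hlim.eventually_lt_const hr1
  have hr2' : (r : ℝ) < 1 := by exact_mod_cast hr2
  refine Summable.of_norm_bounded_eventually_nat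
    (summable_geometric_of_lt_one r.coe_nonneg hr2') ?_
  filter_upwards [hev, eventually_gt_atTop 0] with n hn hn0
  rw [norm_norm]
  refine (norm_invMap_pow_le hR n).trans ?_
  have h3 : (‖S ^ n‖₊ : ENNReal) < (r : ENNReal) ^ n := by
    have h4 := ENNReal.rpow_lt_rpow hn (z := (n : ℝ)) (by exact_mod_cast hn0)
    rw [← ENNReal.rpow_mul, one_div, inv_mul_cancel₀ (by positivity), ENNReal.rpow_one,
      ENNReal.rpow_natCast] at h4
    exact h4
  have h5 : ‖S ^ n‖₊ < r ^ n := by exact_mod_cast h3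
  have h6 : ‖S ^ n‖ < (r : ℝ) ^ n := by exact_mod_cast h5
  exact h6.le

lemma exists_norm_latticeVec_le (B : Finset (Fin d → ℤ)) :
    ∃ C : ℝ, 0 ≤ C ∧ ∀ b ∈ B, ‖latticeVec b‖ ≤ C :=
  ⟨∑ b ∈ B, ‖latticeVec b‖, Finset.sum_nonneg fun _ _ => norm_nonneg _, fun _ hb =>
    Finset.single_le_sum (f := fun b => ‖latticeVec b‖) (fun _ _ => norm_nonneg _) hb⟩

lemma digitSeries_term_bound (R : Matrix (Fin d) (Fin d) ℤ) {B : Finset (Fin d → ℤ)} {C : ℝ}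
    (hC : ∀ b ∈ B, ‖latticeVec b‖ ≤ C) (k : ℕ) (ω : ℕ → B) :
    ‖(invMap R ^ (k + 1)) (latticeVec (ω k : Fin d → ℤ))‖ ≤ ‖invMap R ^ (k + 1)‖ * C :=
  (ContinuousLinearMap.le_opNorm _ _).trans
    (mul_le_mul_of_nonneg_left (hC _ (ω k).2) (norm_nonneg _))

lemma summable_bound {R : Matrix (Fin d) (Fin d) ℤ} (hR : IsExpansive R) (C : ℝ) :
    Summable fun k : ℕ => ‖invMap R ^ (k + 1)‖ * C :=
  ((summable_nat_add_iff 1).2 (summable_norm_invMap_pow hR)).mul_right C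

lemma summable_digitSeries {R : Matrix (Fin d) (Fin d) ℤ} (hR : IsExpansive R)
    {B : Finset (Fin d → ℤ)} (ω : ℕ → B) :
    Summable fun k : ℕ => (invMap R ^ (k + 1)) (latticeVec (ω k : Fin d → ℤ)) := by
  obtain ⟨C, -, hC⟩ := exists_norm_latticeVec_le B
  exact Summable.of_norm_bounded (summable_bound hR C) fun k => digitSeries_term_bound R hC k ω

lemma continuous_digitSeries {R : Matrix (Fin d) (Fin d) ℤ} (hR : IsExpansive R)
    (B : Finset (Fin d → ℤ)) : Continuous (digitSeries R B) := by
  obtain ⟨C, -, hC⟩ := exists_norm_latticeVec_le B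
  refine continuous_tsum (fun k => ?_) (summable_bound hR C)
    fun k ω => digitSeries_term_bound R hC k ω
  refine (invMap R ^ (k + 1)).continuous.comp ?_
  exact (continuous_of_discreteTopology (f := fun b : B => latticeVec (b : Fin d → ℤ))).comp
    (continuous_apply k)

lemma measurable_digitSeries {R : Matrix (Fin d) (Fin d) ℤ} (hR : IsExpansive R)
    (B : Finset (Fin d → ℤ)) : Measurable (digitSeries R B) :=
  (continuous_digitSeries hR B).measurable

/-- The sequence of digits that starts with `b` and goes on with `ω`. -/
def consDigit {B : Finset (Fin d → ℤ)} (b : B) (ω : ℕ → B) : ℕ → B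
  | 0 => b
  | k + 1 => ω k

lemma digitSeries_consDigit {R : Matrix (Fin d) (Fin d) ℤ} (hR : IsExpansive R)
    {B : Finset (Fin d → ℤ)} (b : B) (ω : ℕ → B) :
    digitSeries R B (consDigit b ω) = tau R b (digitSeries R B ω) := by
  have h := (summable_digitSeries hR (consDigit b ω)).tsum_eq_zero_add
  rw [digitSeries, h, tau, map_add, add_comm, digitSeries,
    (invMap R).map_tsum (summable_digitSeries hR ω)]
  congr 1
  · refine tsum_congr fun k => ?_
    rw [pow_succ' (invMap R) (k + 1)]
    rfl

theorem isCompact_attractor {R : Matrix (Fin d) (Fin d) ℤ} (hR : IsExpansive R)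
    (B : Finset (Fin d → ℤ)) : IsCompact (attractor R B) :=
  isCompact_range (continuous_digitSeries hR B)

theorem attractor_nonempty (R : Matrix (Fin d) (Fin d) ℤ) {B : Finset (Fin d → ℤ)}
    (hB : B.Nonempty) : (attractor R B).Nonempty := by
  obtain ⟨b, hb⟩ := hB
  exact ⟨_, fun _ => ⟨b, hb⟩, rfl⟩

theorem attractor_eq_iUnion {R : Matrix (Fin d) (Fin d) ℤ} (hR : IsExpansive R)
    (B : Finset (Fin d → ℤ)) : attractor R B = ⋃ b ∈ B, tau R b '' attractor R B := by
  ext x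
  simp only [Set.mem_iUnion, exists_prop]
  constructor
  · rintro ⟨ω, rfl⟩
    refine ⟨ω 0, (ω 0).2, digitSeries R B (fun k => ω (k + 1)), ⟨_, rfl⟩, ?_⟩
    rw [← digitSeries_consDigit hR]
    congr 1
    ext k : 1
    cases k <;> rfl
  · rintro ⟨b, hb, _, ⟨ω, rfl⟩, rfl⟩
    exact ⟨consDigit ⟨b, hb⟩ ω, digitSeries_consDigit hR ⟨b, hb⟩ ω⟩

lemma tendsto_invMap_pow {R : Matrix (Fin d) (Fin d) ℤ} (hR : IsExpansive R) :
    Tendsto (fun n : ℕ => ‖invMap R ^ n‖) atTop (𝓝 0) :=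
  (summable_norm_invMap_pow hR).tendsto_atTop_zero

/-- The composition `τ_{b_1} ∘ ⋯ ∘ τ_{b_n}`, in series form. -/
lemma digitSum_add {R : Matrix (Fin d) (Fin d) ℤ} {B : Finset (Fin d → ℤ)} (ω : ℕ → B) (n : ℕ)
    (x : EuclideanSpace ℝ (Fin d)) :
    (∑ k ∈ Finset.range (n + 1), (invMap R ^ (k + 1)) (latticeVec (ω k : Fin d → ℤ))) +
        (invMap R ^ (n + 1)) x =
      (∑ k ∈ Finset.range n, (invMap R ^ (k + 1)) (latticeVec (ω k : Fin d → ℤ))) +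
        (invMap R ^ n) (tau R (ω n) x) := by
  rw [Finset.sum_range_succ, tau, map_add, map_add, pow_succ (invMap R) n]
  simp only [mul_apply_eq_comp]
  abel

lemma tendsto_digitSum_add {R : Matrix (Fin d) (Fin d) ℤ} (hR : IsExpansive R)
    {B : Finset (Fin d → ℤ)} (ω : ℕ → B) {x : ℕ → EuclideanSpace ℝ (Fin d)} {C : ℝ}
    (hx : ∀ n, ‖x n‖ ≤ C) :
    Tendsto (fun n => (∑ k ∈ Finset.range n, (invMap R ^ (k + 1)) (latticeVec (ω k : Fin d → ℤ))) +
        (invMap R ^ n) (x n)) atTop (𝓝 (digitSeries R B ω)) := by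
  have h1 := (summable_digitSeries hR ω).hasSum.tendsto_sum_nat
  have h2 : Tendsto (fun n => (invMap R ^ n) (x n)) atTop (𝓝 0) := by
    refine squeeze_zero_norm (a := fun n => ‖invMap R ^ n‖ * C) (fun n => ?_) ?_
    · exact (ContinuousLinearMap.le_opNorm _ _).trans
        (mul_le_mul_of_nonneg_left (hx n) (norm_nonneg _))
    · simpa using (tendsto_invMap_pow hR).mul_const C
  have h3 := h1.add h2
  rwa [add_zero] at h3

/-- `attractor R B` is the only non-empty compact set `T` with `T = ⋃ b, τ_b(T)`. -/
theorem attractor_unique {R : Matrix (Fin d) (Fin d) ℤ} (hR : IsExpansive R)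
    {B : Finset (Fin d → ℤ)} {T : Set (EuclideanSpace ℝ (Fin d))} (hT : IsCompact T)
    (hne : T.Nonempty) (hinv : T = ⋃ b ∈ B, tau R b '' T) : T = attractor R B := by
  obtain ⟨C, hC⟩ := hT.isBounded.exists_norm_le
  have hmem : ∀ b : B, ∀ x ∈ T, tau R b x ∈ T := by
    intro b x hx
    rw [hinv]
    exact Set.mem_biUnion b.2 ⟨x, hx, rfl⟩
  apply Set.Subset.antisymm
  · intro x hx
    have hpre : ∀ y : T, ∃ p : B × T, tau R p.1 p.2 = y := by
      rintro ⟨y, hy⟩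
      rw [hinv] at hy
      simp only [Set.mem_iUnion, exists_prop] at hy
      obtain ⟨b, hb, z, hz, hzy⟩ := hy
      exact ⟨(⟨b, hb⟩, ⟨z, hz⟩), hzy⟩
    choose p hp using hpre
    let y : ℕ → T := fun n => (fun z => (p z).2)^[n] ⟨x, hx⟩
    have hy : ∀ n, y (n + 1) = (p (y n)).2 := fun n => Function.iterate_succ_apply' _ _ _
    let ω : ℕ → B := fun n => (p (y n)).1
    have hstep : ∀ n, tau R (ω n) (y (n + 1)) = y n := fun n => by rw [hy]; exact hp (y n)
    refine ⟨ω, ?_⟩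
    have hlim := tendsto_digitSum_add hR ω (x := fun n => y n) (fun n => hC _ (y n).2)
    have hconst : ∀ n, (∑ k ∈ Finset.range n,
        (invMap R ^ (k + 1)) (latticeVec (ω k : Fin d → ℤ))) + (invMap R ^ n) (y n) = x := by
      intro n
      induction n with
      | zero => simp [y]
      | succ n ih => rw [digitSum_add, hstep, ih]
    simp only [hconst] at hlim
    exact tendsto_nhds_unique hlim tendsto_const_nhds
  · rintro _ ⟨ω, rfl⟩
    obtain ⟨t, ht⟩ := hne
    have hlim := tendsto_digitSum_add hR ω (x := fun _ => t) (fun _ => hC t ht)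
    refine hT.isClosed.mem_of_tendsto hlim (Eventually.of_forall fun n => ?_)
    have : ∀ n, ∀ s ∈ T, (∑ k ∈ Finset.range n,
        (invMap R ^ (k + 1)) (latticeVec (ω k : Fin d → ℤ))) + (invMap R ^ n) s ∈ T := by
      intro n
      induction n with
      | zero => simp
      | succ n ih =>
        intro s hs
        rw [digitSum_add]
        exact ih _ (hmem _ _ hs)
    exact this n t ht

lemma isProbabilityMeasure_uniformOn {B : Finset (Fin d → ℤ)} (hB : B.Nonempty) :
    IsProbabilityMeasure (ProbabilityTheory.uniformOn (Set.univ : Set B)) := by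
  have : Nonempty B := hB.to_subtype
  exact ProbabilityTheory.isProbabilityMeasure_uniformOn Set.finite_univ Set.univ_nonempty

theorem isProbabilityMeasure_selfAffineMeasure {R : Matrix (Fin d) (Fin d) ℤ}
    (hR : IsExpansive R) {B : Finset (Fin d → ℤ)} (hB : B.Nonempty) :
    IsProbabilityMeasure (selfAffineMeasure R B) := by
  have := isProbabilityMeasure_uniformOn hB
  exact Measure.isProbabilityMeasure_map (measurable_digitSeries hR B).aemeasurable

lemma measurable_consDigit {B : Finset (Fin d → ℤ)} (b : B) : Measurable (consDigit b) := by
  refine measurable_pi_lambda _ fun k => ?_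
  cases k with
  | zero => exact measurable_const
  | succ k => exact measurable_pi_apply k

lemma uniformOn_univ_apply {B : Finset (Fin d → ℤ)} (s : Set B) [DecidablePred (· ∈ s)] :
    ProbabilityTheory.uniformOn (Set.univ : Set B) s =
      ∑ b : B, (B.card : ENNReal)⁻¹ * (if b ∈ s then 1 else 0) := by
  rw [ProbabilityTheory.uniformOn_univ, ← Finset.mul_sum, Finset.sum_boole,
    Measure.count_apply (Set.toFinite s).measurableSet, ENNReal.div_eq_inv_mul, Fintype.card_coe,
    Set.encard_eq_coe_toFinset_card]
  congr 2
  simp [Set.toFinset]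

lemma infinitePi_eq_sum {B : Finset (Fin d → ℤ)} (hB : B.Nonempty) :
    (∑ b : B, (B.card : ENNReal)⁻¹ • (Measure.infinitePi fun _ : ℕ =>
        ProbabilityTheory.uniformOn (Set.univ : Set B)).map (consDigit b)) =
      Measure.infinitePi fun _ : ℕ => ProbabilityTheory.uniformOn (Set.univ : Set B) := by
  classical
  have := isProbabilityMeasure_uniformOn hB
  refine Measure.eq_infinitePi _ fun s t ht => ?_
  obtain ⟨n, hn⟩ : ∃ n, s ⊆ Finset.range (n + 1) :=
    ⟨s.sup id, fun i hi => Finset.mem_range_succ_iff.2 (Finset.le_sup (f := id) hi)⟩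
  let u : ℕ → Set B := fun i => if i ∈ s then t i else Set.univ
  have hu : ∀ i, MeasurableSet (u i) := fun i => by
    by_cases hi : i ∈ s <;> simp [u, hi, ht]
  have hset : Set.pi (s : Set ℕ) t = Set.pi (Finset.range (n + 1) : Set ℕ) u := by
    ext ω
    simp only [Set.mem_pi, Finset.mem_coe]
    constructor
    · intro h i _
      by_cases hi : i ∈ s
      · simpa [u, hi] using h i hi
      · simp [u, hi]
    · intro h i hi
      simpa [u, hi] using h i (hn hi)
  have hprod : ∏ i ∈ s, ProbabilityTheory.uniformOn (Set.univ : Set B) (t i) =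
      ∏ i ∈ Finset.range (n + 1), ProbabilityTheory.uniformOn (Set.univ : Set B) (u i) := by
    rw [← Finset.prod_subset hn]
    · exact Finset.prod_congr rfl fun i hi => by simp [u, hi]
    · intro i _ hi
      simp [u, hi]
  rw [hset, hprod, Finset.prod_range_succ', mul_comm, uniformOn_univ_apply, Finset.sum_mul,
    Measure.finsetSum_apply]
  refine Finset.sum_congr rfl fun b _ => ?_
  rw [Measure.smul_apply, smul_eq_mul, mul_assoc, Measure.map_apply (measurable_consDigit b)
    (MeasurableSet.pi (Finset.countable_toSet _) fun i _ => hu i)]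
  congr 1
  by_cases hb : b ∈ u 0
  · rw [if_pos hb, one_mul, ← Measure.infinitePi_pi _ (fun i _ => hu (i + 1))]
    congr 1
    ext ω
    simp only [Set.mem_preimage, Set.mem_pi, Finset.mem_coe, Finset.mem_range]
    constructor
    · intro h i hi
      exact h (i + 1) (by omega)
    · intro h i hi
      cases i with
      | zero => exact hb
      | succ i => exact h i (by omega)
  · rw [if_neg hb, zero_mul]
    have hempty : consDigit b ⁻¹' Set.pi (Finset.range (n + 1) : Set ℕ) u = ∅ := by
      ext ω
      simp only [Set.mem_preimage, Set.mem_pi, Finset.mem_coe, Finset.mem_range,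
        Set.mem_empty_iff_false, iff_false]
      intro h
      exact hb (h 0 (by omega))
    rw [hempty, measure_empty]

lemma continuous_tau (R : Matrix (Fin d) (Fin d) ℤ) (b : Fin d → ℤ) : Continuous (tau R b) := by
  unfold tau
  fun_prop

lemma selfAffineMeasure_eq_sum_map {R : Matrix (Fin d) (Fin d) ℤ} (hR : IsExpansive R)
    {B : Finset (Fin d → ℤ)} (hB : B.Nonempty) :
    selfAffineMeasure R B =
      ∑ b ∈ B, (B.card : ENNReal)⁻¹ • (selfAffineMeasure R B).map (tau R b) := by
  have hm := measurable_digitSeries hR B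
  conv_lhs => rw [selfAffineMeasure, ← infinitePi_eq_sum hB]
  rw [← Finset.sum_coe_sort B fun b : Fin d → ℤ =>
    (B.card : ENNReal)⁻¹ • (selfAffineMeasure R B).map (tau R b)]
  ext E hE
  rw [Measure.map_apply hm hE, Measure.finsetSum_apply, Measure.finsetSum_apply]
  refine Finset.sum_congr rfl fun b _ => ?_
  rw [Measure.smul_apply, Measure.smul_apply, selfAffineMeasure,
    Measure.map_map (continuous_tau R b).measurable hm, ← Measure.map_apply hm hE,
    Measure.map_map hm (measurable_consDigit b)]
  congr 3
  ext ω : 1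
  exact digitSeries_consDigit hR b ω

/-- The invariance equation `μ(E) = ∑_{b ∈ B} (1/N) μ(τ_b⁻¹(E))`. -/
theorem selfAffineMeasure_apply {R : Matrix (Fin d) (Fin d) ℤ} (hR : IsExpansive R)
    {B : Finset (Fin d → ℤ)} (hB : B.Nonempty) {E : Set (EuclideanSpace ℝ (Fin d))}
    (hE : MeasurableSet E) :
    selfAffineMeasure R B E =
      ∑ b ∈ B, (B.card : ENNReal)⁻¹ * selfAffineMeasure R B (tau R b ⁻¹' E) := by
  conv_lhs => rw [selfAffineMeasure_eq_sum_map hR hB]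
  rw [Measure.finsetSum_apply]
  refine Finset.sum_congr rfl fun b _ => ?_
  rw [Measure.smul_apply, smul_eq_mul, Measure.map_apply (continuous_tau R b).measurable hE]

lemma charFun_of_invariant {R : Matrix (Fin d) (Fin d) ℤ}
    {B : Finset (Fin d → ℤ)} (hB : B.Nonempty) {μ : Measure (EuclideanSpace ℝ (Fin d))}
    [IsProbabilityMeasure μ]
    (h : ∀ E, MeasurableSet E → μ E = ∑ b ∈ B, (B.card : ENNReal)⁻¹ * μ (tau R b ⁻¹' E))
    (t : EuclideanSpace ℝ (Fin d)) :
    charFun μ t = ∑ b ∈ B, (B.card : ℂ)⁻¹ *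
      (Complex.exp ((inner ℝ (invMap R (latticeVec b)) t : ℝ) * Complex.I) *
        charFun μ ((invMap R).adjoint t)) := by
  have hμ : μ = ∑ b ∈ B, (B.card : ENNReal)⁻¹ • μ.map (tau R b) := by
    ext E hE
    rw [h E hE, Measure.finsetSum_apply]
    refine Finset.sum_congr rfl fun b _ => ?_
    rw [Measure.smul_apply, smul_eq_mul, Measure.map_apply (continuous_tau R b).measurable hE]
  have hcard : (B.card : ENNReal)⁻¹ ≠ ⊤ := by simp [hB.ne_empty]
  have hint : ∀ (ν : Measure (EuclideanSpace ℝ (Fin d))) [IsFiniteMeasure ν],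
      Integrable (fun x => Complex.exp ((inner ℝ x t : ℝ) * Complex.I)) ν := by
    intro ν _
    refine Integrable.of_bound (C := 1) (by fun_prop) (Eventually.of_forall fun x => ?_)
    rw [Complex.norm_exp_ofReal_mul_I]
  conv_lhs => rw [hμ]
  rw [charFun_apply, integral_finsetSum_measure]
  · refine Finset.sum_congr rfl fun b _ => ?_
    rw [integral_smul_measure, integral_map (continuous_tau R b).aemeasurable (by fun_prop)]
    rw [charFun_apply, ← integral_const_mul]
    simp only [ENNReal.toReal_inv, ENNReal.toReal_natCast, tau, map_add, inner_add_left,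
      ContinuousLinearMap.adjoint_inner_right, Complex.real_smul]
    push_cast
    congr 2
    ext x
    rw [← Complex.exp_add]
    congr 1
    ring
  · intro b _
    have := Measure.isProbabilityMeasure_map (μ := μ) (continuous_tau R b).aemeasurable
    exact (hint _).smul_measure hcard

/-- `selfAffineMeasure R B` is the only Borel probability measure that satisfies the invariance
equation. -/
theorem selfAffineMeasure_unique {R : Matrix (Fin d) (Fin d) ℤ} (hR : IsExpansive R)
    {B : Finset (Fin d → ℤ)} (hB : B.Nonempty) {μ : Measure (EuclideanSpace ℝ (Fin d))}
    [IsProbabilityMeasure μ]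
    (h : ∀ E, MeasurableSet E → μ E = ∑ b ∈ B, (B.card : ENNReal)⁻¹ * μ (tau R b ⁻¹' E)) :
    μ = selfAffineMeasure R B := by
  have := isProbabilityMeasure_selfAffineMeasure hR hB
  set ν := selfAffineMeasure R B with hν
  have hcont : ∀ (ρ : Measure (EuclideanSpace ℝ (Fin d))) [IsProbabilityMeasure ρ],
      Continuous (charFun ρ) := fun ρ _ => continuous_charFun
  have hcard : (B.card : ℝ) ≠ 0 := by simp [hB.ne_empty]
  have hstep : ∀ t, ‖charFun μ t - charFun ν t‖ ≤
      ‖charFun μ ((invMap R).adjoint t) - charFun ν ((invMap R).adjoint t)‖ := by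
    intro t
    rw [charFun_of_invariant hB h t,
      charFun_of_invariant hB (fun E hE => selfAffineMeasure_apply hR hB hE) t,
      ← Finset.sum_sub_distrib]
    refine (norm_sum_le _ _).trans ?_
    simp only [← mul_sub, norm_mul, Complex.norm_exp_ofReal_mul_I, one_mul, norm_inv,
      Complex.norm_natCast, Finset.sum_const, nsmul_eq_mul]
    rw [mul_inv_cancel_left₀ hcard]
  have hiter : ∀ (n : ℕ) t, ‖charFun μ t - charFun ν t‖ ≤
      ‖charFun μ ((invMap R ^ n).adjoint t) - charFun ν ((invMap R ^ n).adjoint t)‖ := by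
    intro n
    induction n with
    | zero =>
      intro t
      rw [pow_zero, ContinuousLinearMap.one_def, ContinuousLinearMap.adjoint_id]
      rfl
    | succ n ih =>
      intro t
      have hadj : (invMap R ^ (n + 1)).adjoint t =
          (invMap R ^ n).adjoint ((invMap R).adjoint t) := by
        rw [pow_succ', ContinuousLinearMap.mul_def, ContinuousLinearMap.adjoint_comp]
        rfl
      rw [hadj]
      exact (hstep t).trans (ih _)
  refine Measure.ext_of_charFun (funext fun t => ?_)
  have ht : Tendsto (fun n : ℕ => (invMap R ^ n).adjoint t) atTop (𝓝 0) := by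
    refine squeeze_zero_norm (a := fun n => ‖invMap R ^ n‖ * ‖t‖) (fun n => ?_) ?_
    · refine (ContinuousLinearMap.le_opNorm _ _).trans (le_of_eq ?_)
      rw [LinearIsometryEquiv.norm_map]
    · simpa using (tendsto_invMap_pow hR).mul_const ‖t‖
  have hlim : Tendsto (fun n : ℕ => ‖charFun μ ((invMap R ^ n).adjoint t) -
      charFun ν ((invMap R ^ n).adjoint t)‖) atTop (𝓝 0) := by
    have h1 := (((hcont μ).tendsto 0).comp ht).sub (((hcont ν).tendsto 0).comp ht)
    simpa using h1.norm
  have hle := ge_of_tendsto' hlim fun n => hiter n t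
  exact sub_eq_zero.1 (norm_le_zero_iff.1 hle)

end SelfAffine

end

namespace SelfAffine

variable {d : ℕ}

/-! From (i) to (ii): let `E` be the complement of the interior of `T`. Each `τ_b` with `b ∈ B` maps
the interior of `T` into itself, so `τ_b⁻¹(E) ⊆ E`. By invariance `μ(E)` is the average of the
numbers `μ(τ_b⁻¹(E)) ≤ μ(E)`, hence these sets all agree with `E` up to null sets, and so do the
preimages under compositions of the `τ_b`. A point of `T(R,B)` inside the interior of `T` yields
such a composition sending all of `T` into that interior. The preimage of `E` under it misses `T`,
which carries `μ`, and therefore `μ(E) = 0` (`TSOSCWith.selfAffineMeasure_compl_interior`). For a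
tile, `T + k` with `k ≠ 0` misses the interior of `T` (`IsZdTile.disjoint_translate_interior`), so
`T(R,B) + k` is `μ`-null.

From (ii) to (iii): after removal of a null set from `T(R,B)`, the projection to the torus is
injective on a set carrying `μ`. The character `x ↦ e^{-2πi⟨ξ,x⟩}` then descends to a function `h`
on the torus, of modulus one almost everywhere for the projected measure `ν`. If `ξ` were a periodic
zero, all Fourier coefficients of `h dν` would vanish, and density of trigonometric polynomials in
`L²(ν)` would force `h = 0` (`periodicZeroSet_eq_empty`). -/

/-! ### Cylinder maps and the open set condition -/

/-- The composition `τ_{ω 0} ∘ ⋯ ∘ τ_{ω (n - 1)}`. -/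
noncomputable def cylinderMap (R : Matrix (Fin d) (Fin d) ℤ) (ω : ℕ → Fin d → ℤ) :
    ℕ → EuclideanSpace ℝ (Fin d) → EuclideanSpace ℝ (Fin d)
  | 0 => id
  | n + 1 => cylinderMap R ω n ∘ tau R (ω n)

lemma cylinderMap_eq (R : Matrix (Fin d) (Fin d) ℤ) {B : Finset (Fin d → ℤ)} (ω : ℕ → B) (n : ℕ)
    (x : EuclideanSpace ℝ (Fin d)) :
    cylinderMap R (fun k => ω k) n x =
      (∑ k ∈ Finset.range n, (invMap R ^ (k + 1)) (latticeVec (ω k : Fin d → ℤ))) +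
        (invMap R ^ n) x := by
  induction n generalizing x with
  | zero => simp [cylinderMap]
  | succ n ih => rw [digitSum_add, ← ih]; rfl

/-- The linear parts `R⁻ⁿ` tend to zero, so the images of a bounded set shrink to the point with
digits `ω`. If every `n` failed, witnesses `y n ∈ T` with images outside `U` would still have images
converging to that point of the open set `U`. -/
lemma exists_cylinderMap_mapsTo {R : Matrix (Fin d) (Fin d) ℤ} (hR : IsExpansive R)
    {B : Finset (Fin d → ℤ)} (ω : ℕ → B) {T U : Set (EuclideanSpace ℝ (Fin d))}
    (hT : Bornology.IsBounded T) (hU : IsOpen U) (hω : digitSeries R B ω ∈ U) :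
    ∃ n, Set.MapsTo (cylinderMap R (fun k => ω k) n) T U := by
  by_contra! h
  simp only [Set.MapsTo, not_forall] at h
  choose y hyT hyU using h
  obtain ⟨C, hC⟩ := hT.exists_norm_le
  obtain ⟨n, hn⟩ := ((tendsto_digitSum_add hR ω (x := y) fun n => hC _ (hyT n)).eventually
    (hU.mem_nhds hω)).exists
  rw [← cylinderMap_eq] at hn
  exact hyU n hn

lemma cylinderMap_mapsTo (R : Matrix (Fin d) (Fin d) ℤ) {ω : ℕ → Fin d → ℤ}
    {S : Set (EuclideanSpace ℝ (Fin d))} (h : ∀ k, Set.MapsTo (tau R (ω k)) S S) (n : ℕ) :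
    Set.MapsTo (cylinderMap R ω n) S S := by
  induction n with
  | zero => exact Set.mapsTo_id S
  | succ n ih => exact ih.comp (h n)

lemma isOpenMap_tau {R : Matrix (Fin d) (Fin d) ℤ} (hR : IsExpansive R) (b : Fin d → ℤ) :
    IsOpenMap (tau R b) := by
  set A : Matrix (Fin d) (Fin d) ℝ := R.map (fun n : ℤ => (n : ℝ)) with hA
  have hdet : IsUnit A.det := by
    have h : A.det = ((R.det : ℤ) : ℝ) := ((Int.castRingHom ℝ).map_det R).symm
    rw [h, isUnit_iff_ne_zero]
    exact_mod_cast hR.det_ne_zero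
  have h1 : Matrix.toEuclideanCLM (n := Fin d) (𝕜 := ℝ) A * invMap R = 1 := by
    rw [invMap, ← map_mul, Matrix.mul_nonsing_inv _ hdet, map_one]
  have h2 : invMap R * Matrix.toEuclideanCLM (n := Fin d) (𝕜 := ℝ) A = 1 := by
    rw [invMap, ← map_mul, Matrix.nonsing_inv_mul _ hdet, map_one]
  refine IsOpenMap.of_inverse
    (f' := fun x => Matrix.toEuclideanCLM (n := Fin d) (𝕜 := ℝ) A x - latticeVec b)
    (by fun_prop) (fun x => ?_) fun x => ?_
  · rw [tau, sub_add_cancel]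
    exact DFunLike.congr_fun h2 x
  · rw [tau]
    exact sub_eq_iff_eq_add.2 (DFunLike.congr_fun h1 (x + latticeVec b))

lemma isOpenMap_cylinderMap {R : Matrix (Fin d) (Fin d) ℤ} (hR : IsExpansive R)
    (ω : ℕ → Fin d → ℤ) (n : ℕ) : IsOpenMap (cylinderMap R ω n) := by
  induction n with
  | zero => exact IsOpenMap.id
  | succ n ih => exact ih.comp (isOpenMap_tau hR _)

lemma tau_mapsTo_attractor {R : Matrix (Fin d) (Fin d) ℤ} (hR : IsExpansive R)
    {C : Finset (Fin d → ℤ)} {b : Fin d → ℤ} (hb : b ∈ C) :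
    Set.MapsTo (tau R b) (attractor R C) (attractor R C) := by
  intro x hx
  rw [attractor_eq_iUnion hR]
  exact Set.mem_biUnion hb ⟨x, hx, rfl⟩

lemma tau_mapsTo_interior_attractor {R : Matrix (Fin d) (Fin d) ℤ} (hR : IsExpansive R)
    {C : Finset (Fin d → ℤ)} {b : Fin d → ℤ} (hb : b ∈ C) :
    Set.MapsTo (tau R b) (interior (attractor R C)) (interior (attractor R C)) :=
  (isOpenMap_tau hR b).mapsTo_interior (tau_mapsTo_attractor hR hb)

lemma attractor_mono (R : Matrix (Fin d) (Fin d) ℤ) {B C : Finset (Fin d → ℤ)} (h : B ⊆ C) :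
    attractor R B ⊆ attractor R C := by
  rintro _ ⟨ω, rfl⟩
  exact ⟨fun k => ⟨ω k, h (ω k).2⟩, rfl⟩

/-! ### Support and invariance of the self-affine measure -/

lemma selfAffineMeasure_compl_attractor {R : Matrix (Fin d) (Fin d) ℤ} (hR : IsExpansive R)
    (B : Finset (Fin d → ℤ)) : selfAffineMeasure R B (attractor R B)ᶜ = 0 := by
  rw [selfAffineMeasure, Measure.map_apply (measurable_digitSeries hR B)
    (isCompact_attractor hR B).measurableSet.compl]
  have hpre : digitSeries R B ⁻¹' (attractor R B)ᶜ = ∅ := by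
    ext ω
    simp [attractor]
  rw [hpre, measure_empty]

/-- The invariance equation writes the mass of a null set as a sum of nonnegative terms, so each
preimage is null. This allows almost everywhere equalities to be pulled back along `tau R b`. -/
lemma quasiMeasurePreserving_tau {R : Matrix (Fin d) (Fin d) ℤ} (hR : IsExpansive R)
    {B : Finset (Fin d → ℤ)} {b : Fin d → ℤ} (hb : b ∈ B) :
    Measure.QuasiMeasurePreserving (tau R b) (selfAffineMeasure R B) (selfAffineMeasure R B) := by
  refine ⟨(continuous_tau R b).measurable, Measure.AbsolutelyContinuous.mk fun s hs h0 => ?_⟩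
  rw [selfAffineMeasure_apply hR ⟨b, hb⟩ hs, Finset.sum_eq_zero_iff] at h0
  rw [Measure.map_apply (continuous_tau R b).measurable hs]
  exact (mul_eq_zero.1 (h0 b hb)).resolve_left (by simp)

/-- A set that contains its preimages under the maps of the iterated function system agrees with
each of them up to a null set. -/
lemma tau_preimage_ae_eq {R : Matrix (Fin d) (Fin d) ℤ} (hR : IsExpansive R)
    {B : Finset (Fin d → ℤ)} {E : Set (EuclideanSpace ℝ (Fin d))} (hE : MeasurableSet E)
    (h : ∀ b ∈ B, tau R b ⁻¹' E ⊆ E) {b : Fin d → ℤ} (hb : b ∈ B) :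
    tau R b ⁻¹' E =ᵐ[selfAffineMeasure R B] E := by
  have := isProbabilityMeasure_selfAffineMeasure hR ⟨b, hb⟩
  set μ := selfAffineMeasure R B
  have hcard : (B.card : ENNReal) ≠ 0 := by simpa using Finset.ne_empty_of_mem hb
  have hinv : (B.card : ENNReal)⁻¹ ≠ 0 := by simp
  have hinv' : (B.card : ENNReal)⁻¹ ≠ ⊤ := by simpa using hcard
  refine ae_eq_of_subset_of_measure_ge (h b hb) ?_
    ((continuous_tau R b).measurable hE).nullMeasurableSet (measure_ne_top _ _)
  -- A strict loss of mass for a single digit would make the average over `B` strictly smaller than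
  -- `μ E`.
  by_contra! hlt
  refine (lt_irrefl (μ E)) ?_
  calc μ E = ∑ c ∈ B, (B.card : ENNReal)⁻¹ * μ (tau R c ⁻¹' E) :=
        selfAffineMeasure_apply hR ⟨b, hb⟩ hE
    _ < ∑ c ∈ B, (B.card : ENNReal)⁻¹ * μ E := by
        rw [← Finset.add_sum_erase _ _ hb, ← Finset.add_sum_erase _ _ hb]
        refine ENNReal.add_lt_add_of_lt_of_le ?_ (ENNReal.mul_lt_mul_right hinv hinv' hlt)
          (Finset.sum_le_sum fun c hc =>
            mul_le_mul_right (measure_mono (h c (Finset.mem_of_mem_erase hc))) _)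
        exact ENNReal.sum_ne_top.2 fun c _ => ENNReal.mul_ne_top hinv' (measure_ne_top _ _)
    _ = μ E := by
        rw [Finset.sum_const, nsmul_eq_mul, ← mul_assoc,
          ENNReal.mul_inv_cancel hcard (ENNReal.natCast_ne_top _), one_mul]

lemma cylinderMap_preimage_ae_eq {R : Matrix (Fin d) (Fin d) ℤ} (hR : IsExpansive R)
    {B : Finset (Fin d → ℤ)} {E : Set (EuclideanSpace ℝ (Fin d))} (hE : MeasurableSet E)
    (h : ∀ b ∈ B, tau R b ⁻¹' E ⊆ E) (ω : ℕ → B) (n : ℕ) :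
    cylinderMap R (fun k => ω k) n ⁻¹' E =ᵐ[selfAffineMeasure R B] E := by
  induction n with
  | zero => exact ae_eq_refl _
  | succ n ih =>
    rw [cylinderMap, Set.preimage_comp]
    exact ((quasiMeasurePreserving_tau hR (ω n).2).preimage_ae_eq ih).trans
      (tau_preimage_ae_eq hR hE h (ω n).2)

/-- Under the `T`-strong open set condition the self-affine measure is carried by the interior of
`T`. -/
theorem TSOSCWith.selfAffineMeasure_compl_interior {R : Matrix (Fin d) (Fin d) ℤ}
    (hR : IsExpansive R) {B C : Finset (Fin d → ℤ)} (h : TSOSCWith R B C) :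
    selfAffineMeasure R B (interior (attractor R C))ᶜ = 0 := by
  obtain ⟨-, hBC, -, ⟨ω, rfl⟩, hω⟩ := h
  obtain ⟨n, hn⟩ := exists_cylinderMap_mapsTo hR ω (isCompact_attractor hR C).isBounded
    isOpen_interior hω
  -- The complement of the interior may be replaced by its preimage under the cylinder map of `hn`,
  -- and that preimage misses the attractor of `B`.
  rw [← measure_congr (cylinderMap_preimage_ae_eq hR isOpen_interior.measurableSet.compl
    (fun b hb x hx hx' => hx (tau_mapsTo_interior_attractor hR (hBC hb) hx')) ω n)]
  refine measure_mono_null (fun x hx => ?_) (selfAffineMeasure_compl_attractor hR B)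
  exact fun hxB => hx (hn (attractor_mono R hBC hxB))

/-! ### Integer translates of the tile -/

lemma translate_eq_preimage (T : Set (EuclideanSpace ℝ (Fin d))) (k : Fin d → ℤ) :
    translate T k = (fun x => x - latticeVec k) ⁻¹' T := by
  rw [translate, Set.image_add_right]
  simp [sub_eq_add_neg]

@[simp]
lemma latticeVec_zero : latticeVec (0 : Fin d → ℤ) = 0 := by
  ext i
  simp [latticeVec]

lemma latticeVec_add (k l : Fin d → ℤ) : latticeVec (k + l) = latticeVec k + latticeVec l := by
  ext i
  simp [latticeVec]

@[simp]
lemma translate_zero (T : Set (EuclideanSpace ℝ (Fin d))) : translate T 0 = T := by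
  simp [translate]

/-- A nontrivial integer translate of a self-affine `ℤ^d`-tile misses the interior of the tile. -/
lemma IsZdTile.disjoint_translate_interior {R : Matrix (Fin d) (Fin d) ℤ} (hR : IsExpansive R)
    {C : Finset (Fin d → ℤ)} (h : IsZdTile (attractor R C))
    (hne : (interior (attractor R C)).Nonempty) {k : Fin d → ℤ} (hk : k ≠ 0) :
    Disjoint (translate (attractor R C) k) (interior (attractor R C)) := by
  rw [Set.disjoint_left]
  rintro _ ⟨_, ⟨ω, rfl⟩, rfl⟩ hx
  have hcont : Continuous fun x : EuclideanSpace ℝ (Fin d) => x + latticeVec k := by fun_prop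
  -- A common point yields a small copy of the whole tile around it whose translate by `k` stays in
  -- the interior.
  obtain ⟨n, hn⟩ := exists_cylinderMap_mapsTo hR ω (isCompact_attractor hR C).isBounded
    (isOpen_interior.preimage hcont) hx
  -- The small copy of the interior, translated by `k`, is open, nonempty and contained in both
  -- tiles, so the overlap has positive Lebesgue measure.
  have hopen : IsOpen ((fun x => x + latticeVec k) ''
      (cylinderMap R (fun k => ω k) n '' interior (attractor R C))) :=
    isOpenMap_add_right _ _ (isOpenMap_cylinderMap hR _ n _ isOpen_interior)
  refine (hopen.measure_pos volume ((hne.image _).image _)).ne' ?_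
  refine measure_mono_null ?_ (h.2 k 0 hk)
  rintro _ ⟨_, ⟨x, hx, rfl⟩, rfl⟩
  refine ⟨⟨_, cylinderMap_mapsTo R (fun j => tau_mapsTo_attractor hR (ω j).2) n
    (interior_subset hx), rfl⟩, ?_⟩
  rw [translate_zero]
  exact interior_subset (hn (interior_subset hx))

/-- Of two distinct integer vectors at least one is nonzero, and the corresponding translate of the
attractor of `B` alone is already null. -/
theorem TSOSCWith.selfAffineMeasure_translate_inter {R : Matrix (Fin d) (Fin d) ℤ}
    (hR : IsExpansive R) {B C : Finset (Fin d → ℤ)} (h : TSOSCWith R B C)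
    (hT : IsZdTile (attractor R C)) {k k' : Fin d → ℤ} (hk : k ≠ k') :
    selfAffineMeasure R B (translate (attractor R B) k ∩ translate (attractor R B) k') = 0 := by
  have hnull : ∀ j : Fin d → ℤ, j ≠ 0 →
      selfAffineMeasure R B (translate (attractor R B) j) = 0 := fun j hj =>
    measure_mono_null ((Set.image_mono (attractor_mono R h.2.1)).trans
      (hT.disjoint_translate_interior hR (h.2.2.mono Set.inter_subset_right)
        hj).subset_compl_right) (h.selfAffineMeasure_compl_interior hR)
  by_cases hk0 : k = 0
  · exact measure_mono_null Set.inter_subset_right (hnull k' (hk0 ▸ hk.symm))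
  · exact measure_mono_null Set.inter_subset_left (hnull k hk0)

/-! ### Fourier uniqueness on the torus -/

/-- A square-integrable function on the torus all of whose Fourier coefficients with respect to a
finite measure vanish is almost everywhere zero. -/
lemma ae_eq_zero_of_integral_mFourier_mul {ι : Type*} [Fintype ι] {ν : Measure (UnitAddTorus ι)}
    [IsFiniteMeasure ν] {h : UnitAddTorus ι → ℂ} (hm : MemLp h 2 ν)
    (h0 : ∀ n : ι → ℤ, ∫ y, UnitAddTorus.mFourier n y * h y ∂ν = 0) : h =ᵐ[ν] 0 := by
  -- Trigonometric polynomials are uniformly dense in the continuous functions, which are dense in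
  -- `L²(ν)` because `ν` is finite.
  have hdense := (ContinuousMap.toLp_denseRange (p := 2) ℂ ν ℂ
    ENNReal.ofNat_ne_top).topologicalClosure_map_submodule
    (UnitAddTorus.span_mFourier_closure_eq_top (d := ι))
  have hz : hm.toLp h = 0 := by
    refine Dense.eq_zero_of_inner_right (𝕜 := ℂ) ((Submodule.dense_iff_topologicalClosure_eq_top).2
      hdense) ?_
    rintro _ ⟨f, hf, rfl⟩
    induction hf using Submodule.span_induction with
    | mem f hf =>
      obtain ⟨n, rfl⟩ := hf
      -- The inner product conjugates its first argument, which turns frequency `n` into `-n`.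
      rw [L2.inner_def, ← h0 (-n)]
      refine integral_congr_ae ?_
      filter_upwards [hm.coeFn_toLp,
        ContinuousMap.coeFn_toLp (p := 2) (𝕜 := ℂ) ν (UnitAddTorus.mFourier n)] with y h1 h2
      simp only [ContinuousLinearMap.coe_coe]
      rw [h1, h2, UnitAddTorus.mFourier_neg, RCLike.inner_apply, mul_comm]
    | zero => simp
    | add f g _ _ hf hg => rw [map_add, inner_add_left, hf, hg, add_zero]
    | smul c f _ hf => rw [map_smul, inner_smul_left, hf, mul_zero]
  exact (hm.coeFn_toLp.symm.trans (by rw [hz])).trans (Lp.coeFn_zero _ _ _)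

/-! ### Projection to the torus and descent of characters -/

/-- The projection of `ℝ^d` onto the torus `ℝ^d / ℤ^d`. -/
def toTorus (x : EuclideanSpace ℝ (Fin d)) : UnitAddTorus (Fin d) := fun i => (x i : UnitAddCircle)

lemma continuous_toTorus : Continuous (toTorus (d := d)) :=
  continuous_pi fun i => (AddCircle.continuous_mk' 1).comp (by fun_prop)

lemma exists_eq_add_latticeVec {x y : EuclideanSpace ℝ (Fin d)} (h : toTorus x = toTorus y) :
    ∃ k, x = y + latticeVec k := by
  have : ∀ i, ∃ k : ℤ, x i = y i + k := fun i => by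
    obtain ⟨k, hk⟩ := AddSubgroup.mem_zmultiples_iff.1
      ((QuotientAddGroup.eq (s := AddSubgroup.zmultiples (1 : ℝ))).1 (congrFun h i).symm)
    exact ⟨k, by simp at hk; linarith⟩
  choose k hk using this
  exact ⟨k, by ext i; simpa [latticeVec] using hk i⟩

lemma mFourier_toTorus (n : Fin d → ℤ) (x : EuclideanSpace ℝ (Fin d)) :
    UnitAddTorus.mFourier n (toTorus x) =
      Complex.exp (2 * Real.pi * Complex.I * (inner ℝ (latticeVec n) x : ℝ)) := by
  simp only [UnitAddTorus.mFourier, ContinuousMap.coe_mk, toTorus, fourier_coe_apply,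
    ← Complex.exp_sum]
  simp only [PiLp.inner_apply, latticeVec, RCLike.inner_apply, conj_trivial, Complex.ofReal_sum,
    Finset.mul_sum]
  congr 1
  refine Finset.sum_congr rfl fun i _ => ?_
  push_cast
  ring

/-- A probability measure carried by a set whose integer translates are disjoint has no periodic
zeros of its Fourier transform. -/
theorem periodicZeroSet_eq_empty {μ : Measure (EuclideanSpace ℝ (Fin d))} [IsProbabilityMeasure μ]
    {S : Set (EuclideanSpace ℝ (Fin d))} (hS : MeasurableSet S) (hμ : ∀ᵐ x ∂μ, x ∈ S)
    (hdisj : ∀ x ∈ S, ∀ k : Fin d → ℤ, k ≠ 0 → x + latticeVec k ∉ S) :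
    periodicZeroSet μ = ∅ := by
  refine Set.eq_empty_of_forall_notMem fun ξ hξ => ?_
  have hinj : Set.InjOn toTorus S := fun x hx y hy hxy => by
    obtain ⟨k, rfl⟩ := exists_eq_add_latticeVec hxy
    have hk : k = 0 := by_contra fun hk => hdisj y hy k hk hx
    simp [hk]
  -- Lusin–Souslin: a continuous injection on a Borel subset of a Polish space has a Borel inverse
  -- on its image, so the character descends to a measurable `h`.
  have hemb := ContinuousOn.measurableEmbedding hS continuous_toTorus.continuousOn hinj
  have he : Continuous fun x : EuclideanSpace ℝ (Fin d) =>
      Complex.exp (-2 * Real.pi * Complex.I * (inner ℝ ξ x : ℝ)) := by fun_prop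
  obtain ⟨h, hmeas, hh⟩ := hemb.exists_measurable_extend
    (he.measurable.comp measurable_subtype_coe) fun _ => ⟨0⟩
  have hh' : ∀ x ∈ S, h (toTorus x) =
      Complex.exp (-2 * Real.pi * Complex.I * (inner ℝ ξ x : ℝ)) :=
    fun x hx => congrFun hh ⟨x, hx⟩
  have hnorm : ∀ x ∈ S, ‖h (toTorus x)‖ = 1 := fun x hx => by
    rw [hh' x hx, ← Complex.norm_exp_ofReal_mul_I (-2 * Real.pi * inner ℝ ξ x)]
    congr 2
    push_cast
    ring
  have hπ : AEMeasurable (toTorus (d := d)) μ := continuous_toTorus.aemeasurable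
  have := Measure.isProbabilityMeasure_map hπ
  have hLp : MemLp h 2 (μ.map toTorus) := by
    refine MemLp.of_bound hmeas.aestronglyMeasurable 1 ?_
    rw [ae_map_iff hπ (measurableSet_le hmeas.norm measurable_const)]
    filter_upwards [hμ] with x hx using (hnorm x hx).le
  -- The coefficient of `h` at frequency `n` equals `μ̂(ξ - n)`.
  have hzero := ae_eq_zero_of_integral_mFourier_mul hLp fun n => by
    rw [integral_map hπ (by fun_prop), ← hξ (-n), fourierTransform]
    refine integral_congr_ae ?_
    filter_upwards [hμ] with x hx
    have hneg : latticeVec (-n) = -latticeVec n := by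
      rw [eq_neg_iff_add_eq_zero, ← latticeVec_add, neg_add_cancel, latticeVec_zero]
    rw [hh' x hx, mFourier_toTorus, ← Complex.exp_add, hneg, inner_add_left, inner_neg_left]
    congr 1
    push_cast
    ring
  have hfalse : ∀ᵐ x ∂μ, False := by
    filter_upwards [ae_of_ae_map hπ hzero, hμ] with x h1 h2
    have h3 := hnorm x h2
    rw [h1] at h3
    simp at h3
  exact hfalse.exists.elim fun _ h => h

theorem periodicZeroSet_selfAffineMeasure_eq_empty {R : Matrix (Fin d) (Fin d) ℤ}
    (hR : IsExpansive R) {B : Finset (Fin d → ℤ)} (hB : B.Nonempty)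
    (h : ∀ k k' : Fin d → ℤ, k ≠ k' → selfAffineMeasure R B
      (translate (attractor R B) k ∩ translate (attractor R B) k') = 0) :
    periodicZeroSet (selfAffineMeasure R B) = ∅ := by
  have := isProbabilityMeasure_selfAffineMeasure hR hB
  have hK : MeasurableSet (attractor R B) := (isCompact_attractor hR B).measurableSet
  have htr : ∀ k, MeasurableSet (translate (attractor R B) k) := fun k => by
    rw [translate_eq_preimage]
    exact (show Continuous fun x : EuclideanSpace ℝ (Fin d) => x - latticeVec k by
      fun_prop).measurable hK
  -- Only countably many null overlaps with nontrivial translates are discarded. If `x` is in the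
  -- attractor, `x + k` lies in its translate by `k`, which has been removed when `k ≠ 0`.
  refine periodicZeroSet_eq_empty
    (S := attractor R B \ ⋃ k : {k : Fin d → ℤ // k ≠ 0}, translate (attractor R B) k)
    (hK.diff (MeasurableSet.iUnion fun k => htr k)) ?_ ?_
  · have h1 : ∀ᵐ x ∂selfAffineMeasure R B, ∀ k : {k : Fin d → ℤ // k ≠ 0},
        x ∉ attractor R B ∩ translate (attractor R B) k := ae_all_iff.2 fun k => by
      have h2 := h 0 k k.2.symm
      rw [translate_zero] at h2
      exact measure_eq_zero_iff_ae_notMem.1 h2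
    have h2 : ∀ᵐ x ∂selfAffineMeasure R B, x ∈ attractor R B :=
      selfAffineMeasure_compl_attractor hR B
    filter_upwards [h1, h2] with x hx1 hx2
    simp only [Set.mem_sdiff, Set.mem_iUnion, not_exists]
    exact ⟨hx2, fun k hk => hx1 k ⟨hx2, hk⟩⟩
  · rintro x ⟨hx, -⟩ k hk ⟨-, hx'⟩
    exact hx' (Set.mem_iUnion.2 ⟨⟨k, hk⟩, x, hx, rfl⟩)

end SelfAffine

theorem mainTheorem9 (d : ℕ) (R : Matrix (Fin d) (Fin d) ℤ) (hR : SelfAffine.IsExpansive R)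
    (B : Finset (Fin d → ℤ)) (hB : B.Nonempty) :
    ((∃ C : Finset (Fin d → ℤ),
        SelfAffine.TSOSCWith R B C ∧ SelfAffine.IsZdTile (SelfAffine.attractor R C)) →
      ∀ k k' : Fin d → ℤ, k ≠ k' →
        SelfAffine.selfAffineMeasure R B
          (SelfAffine.translate (SelfAffine.attractor R B) k ∩
            SelfAffine.translate (SelfAffine.attractor R B) k') = 0) ∧
    ((∀ k k' : Fin d → ℤ, k ≠ k' →
        SelfAffine.selfAffineMeasure R B
          (SelfAffine.translate (SelfAffine.attractor R B) k ∩
            SelfAffine.translate (SelfAffine.attractor R B) k') = 0) →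
      SelfAffine.periodicZeroSet (SelfAffine.selfAffineMeasure R B) = ∅) := by
  refine ⟨?_, SelfAffine.periodicZeroSet_selfAffineMeasure_eq_empty hR hB⟩
  rintro ⟨C, hC, hT⟩ k k' hk
  exact hC.selfAffineMeasure_translate_inter hR hT hk
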